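/- Let $n\ge 1$ and let $X=(\mathbb{C}^n,\|\cdot\|)$ be an $n$-dimensional complex Banach space whose norm is absolute, that is, $\|(a_1,\dots,a_n)\|=\|(|a_1|,\dots,|a_n|)\|$ for all $a_1,\dots,a_n\in\mathbb{C}$, and $\|e_1\|=\dots=\|e_n\|=1$ for the canonical basis $e_1,\dots,e_n$. A map $P\colon X\to X$ is a polynomial if it is a finite sum of homogeneous polynomials, i.e. of maps $x\mapsto L(x,\dots,x)$ with $L\colon X^k\to X$ continuous and $k$-linear, $k\ge 0$ (constants for $k=0$); its norm is $\|P\|=\sup_{\|x\|\le 1}\|P(x)\|$ and its numerical radius is $$v(P)=\sup\{|x^*(P(x))| : x\in X,\ x^*\in X^*,\ \|x\|=\|x^*\|=x^*(x)=1\}.$$ The analytic numerical index of $X$ is $$n_a(X)=\inf\{v(P) : P\colon X\to X \text{ a polynomial},\ \|P\|=1\}.$$ Then $n_a(X)=1$ if and only if $X$ is isometric (by a complex-linear isometry) to $\ell_\infty^n$, i.e. to $\mathbb{C}^n$ with the norm $\max_j|a_j|$. -/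

import Mathlib

/-- The norm of `X` is an absolute norm with respect to the coordinates given by the basis `e`:
`‖∑ aᵢ eᵢ‖ = ‖∑ |aᵢ| eᵢ‖` for all scalars `aᵢ`, and every `eᵢ` has norm one.
Through `e` the space `X` is identified with `ℂⁿ` and `e` with the canonical basis. -/
structure IsAbsoluteNorm {n : ℕ} {X : Type*} [NormedAddCommGroup X] [NormedSpace ℂ X]
    (e : Module.Basis (Fin n) ℂ X) : Prop where
  norm_sum_abs : ∀ a : Fin n → ℂ, ‖∑ i, a i • e i‖ = ‖∑ i, ((‖a i‖ : ℝ) : ℂ) • e i‖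
  norm_basis : ∀ i, ‖e i‖ = 1

/-- `P : X → Y` is a `k`-homogeneous polynomial: `P x = L (x, …, x)` for a continuous
`k`-linear map `L`. For `k = 0` these are the constant maps. -/
def IsHomogeneousPolynomial {X Y : Type*} [NormedAddCommGroup X] [NormedSpace ℂ X]
    [NormedAddCommGroup Y] [NormedSpace ℂ Y] (k : ℕ) (P : X → Y) : Prop :=
  ∃ L : ContinuousMultilinearMap ℂ (fun _ : Fin k => X) Y, ∀ x, P x = L (fun _ => x)

/-- `P : X → Y` is a polynomial: a finite sum of homogeneous polynomials. -/
def IsPolynomialMap {X Y : Type*} [NormedAddCommGroup X] [NormedSpace ℂ X]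
    [NormedAddCommGroup Y] [NormedSpace ℂ Y] (P : X → Y) : Prop :=
  ∃ (m : ℕ) (Q : ℕ → X → Y), (∀ k, IsHomogeneousPolynomial k (Q k)) ∧
    ∀ x, P x = ∑ k ∈ Finset.range (m + 1), Q k x

/-- The norm `sup {‖f x‖ : ‖x‖ ≤ 1}` of a map which is bounded on the closed unit ball
(as every polynomial is). -/
noncomputable def unitBallNorm {X Y : Type*} [NormedAddCommGroup X] [NormedAddCommGroup Y]
    (f : X → Y) : ℝ :=
  sSup {r : ℝ | ∃ x : X, ‖x‖ ≤ 1 ∧ r = ‖f x‖}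

/-- The numerical radius `sup {|x*(f x)| : x ∈ S_X, x* ∈ S_{X*}, x* x = 1}`. -/
noncomputable def numericalRadius {X : Type*} [NormedAddCommGroup X] [NormedSpace ℂ X]
    (f : X → X) : ℝ :=
  sSup {r : ℝ | ∃ (x : X) (φ : StrongDual ℂ X),
    ‖x‖ = 1 ∧ ‖φ‖ = 1 ∧ φ x = 1 ∧ r = ‖φ (f x)‖}

/-- The analytic numerical index: the infimum of the numerical radii of the polynomials
`P : X → X` of norm one. -/
noncomputable def analyticNumericalIndex (X : Type*) [NormedAddCommGroup X]
    [NormedSpace ℂ X] : ℝ :=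
  sInf {r : ℝ | ∃ P : X → X, IsPolynomialMap P ∧ unitBallNorm P = 1 ∧ r = numericalRadius P}

/-- Equality in the triangle inequality: all summands have the same phase. -/
theorem exists_phase_of_norm_sum_eq {ι : Type*} [Fintype ι] (z : ι → ℂ)
    (h : ‖∑ i, z i‖ = ∑ i, ‖z i‖) :
    ∃ u : ℂ, ‖u‖ = 1 ∧ ∀ i, z i = ‖z i‖ * u := by
  by_cases hS : ∑ i, z i = 0
  · refine ⟨1, by simp, fun i => ?_⟩
    rw [hS, norm_zero] at h
    have := (Finset.sum_eq_zero_iff_of_nonneg (fun i _ => norm_nonneg (z i))).1 h.symm i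
      (Finset.mem_univ i)
    simp [norm_eq_zero.1 this]
  · set S := ∑ i, z i with hSdef
    have hn : (‖S‖ : ℂ) ≠ 0 := by exact_mod_cast (norm_pos_iff.2 hS).ne'
    obtain ⟨u, hu⟩ : ∃ u : ℂ, u = S / ‖S‖ := ⟨_, rfl⟩
    have hu1 : ‖u‖ = 1 := by
      rw [hu, norm_div, Complex.norm_real, norm_norm, div_self (norm_pos_iff.2 hS).ne']
    have huu : (starRingEnd ℂ) u * u = 1 := by
      rw [mul_comm, Complex.mul_conj, Complex.normSq_eq_norm_sq, hu1]; simp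
    have hle : ∀ i ∈ Finset.univ, (z i * (starRingEnd ℂ) u).re ≤ ‖z i‖ := fun i _ =>
      (Complex.re_le_norm _).trans (by simp [hu1])
    have hsum : ∑ i, (z i * (starRingEnd ℂ) u).re = ∑ i, ‖z i‖ := by
      rw [← h, ← Complex.re_sum, ← Finset.sum_mul, ← hSdef]
      have hSu : S = ‖S‖ * u := by rw [hu]; field_simp
      calc (S * (starRingEnd ℂ) u).re = ((‖S‖ : ℂ) * ((starRingEnd ℂ) u * u)).re := by
            conv_lhs => rw [hSu]
            congr 1; ring
        _ = ‖S‖ := by rw [huu]; simp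
    refine ⟨u, hu1, fun i => ?_⟩
    have hi := (Finset.sum_eq_sum_iff_of_le hle).1 hsum i (Finset.mem_univ i)
    have hre : (z i * (starRingEnd ℂ) u).re = ‖z i * (starRingEnd ℂ) u‖ := by
      rw [hi]; simp [hu1]
    have hz : z i * (starRingEnd ℂ) u = ‖z i‖ := by
      have := Complex.re_eq_norm.1 hre
      rw [Complex.eq_coe_norm_of_nonneg this]; simp [hu1]
    calc z i = z i * ((starRingEnd ℂ) u * u) := by rw [huu, mul_one]
      _ = ‖z i‖ * u := by rw [← mul_assoc, hz]

section UnitBallNorm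

variable {X Y : Type*} [NormedAddCommGroup X] [NormedAddCommGroup Y]

theorem unitBallNorm_nonneg (f : X → Y) : 0 ≤ unitBallNorm f :=
  Real.sSup_nonneg (by rintro _ ⟨x, -, rfl⟩; exact norm_nonneg _)

theorem exists_norm_eq_unitBallNorm [ProperSpace X] {f : X → Y} (hf : Continuous f) :
    ∃ x, ‖x‖ ≤ 1 ∧ ‖f x‖ = unitBallNorm f ∧ ∀ z, ‖z‖ ≤ 1 → ‖f z‖ ≤ unitBallNorm f := by
  obtain ⟨x, hx, hmax⟩ := (isCompact_closedBall (0 : X) 1).exists_isMaxOn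
    ⟨0, by simp⟩ hf.norm.continuousOn
  have hg : IsGreatest {r : ℝ | ∃ x : X, ‖x‖ ≤ 1 ∧ r = ‖f x‖} ‖f x‖ := by
    refine ⟨⟨x, by simpa using hx, rfl⟩, ?_⟩
    rintro _ ⟨z, hz, rfl⟩
    exact hmax (by simpa using hz)
  have he : unitBallNorm f = ‖f x‖ := hg.csSup_eq
  exact ⟨x, by simpa using hx, he.symm, fun z hz => he ▸ hg.2 ⟨z, hz, rfl⟩⟩

theorem norm_le_unitBallNorm [ProperSpace X] {f : X → Y} (hf : Continuous f) {x : X}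
    (hx : ‖x‖ ≤ 1) : ‖f x‖ ≤ unitBallNorm f :=
  (exists_norm_eq_unitBallNorm hf).choose_spec.2.2 x hx

theorem unitBallNorm_smul_const [ProperSpace X] [NormedSpace ℂ Y] {g : X → ℂ}
    (hg : Continuous g) (y : Y) :
    unitBallNorm (fun x => g x • y) = unitBallNorm g * ‖y‖ := by
  have hc : Continuous fun x => g x • y := hg.smul continuous_const
  obtain ⟨x, hx, hxe, -⟩ := exists_norm_eq_unitBallNorm hg
  obtain ⟨z, hz, hze, -⟩ := exists_norm_eq_unitBallNorm hc
  apply le_antisymm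
  · rw [← hze, norm_smul]
    exact mul_le_mul_of_nonneg_right (norm_le_unitBallNorm hg hz) (norm_nonneg _)
  · rw [← hxe, ← norm_smul]
    exact norm_le_unitBallNorm hc hx

end UnitBallNorm

section Polynomial

variable {X Y : Type*} [NormedAddCommGroup X] [NormedSpace ℂ X]
  [NormedAddCommGroup Y] [NormedSpace ℂ Y]

theorem IsHomogeneousPolynomial.differentiable {k : ℕ} {P : X → Y}
    (hP : IsHomogeneousPolynomial k P) : Differentiable ℂ P := by
  obtain ⟨L, hL⟩ := hP
  rw [funext hL]
  have h : Differentiable ℂ L := (L.contDiff (n := 1)).differentiable (by norm_num)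
  exact h.comp (differentiable_pi.2 fun _ => differentiable_id)

theorem IsPolynomialMap.differentiable {P : X → Y} (hP : IsPolynomialMap P) :
    Differentiable ℂ P := by
  obtain ⟨m, Q, hQ, hPQ⟩ := hP
  rw [funext hPQ]
  exact Differentiable.fun_sum fun k _ => (hQ k).differentiable

theorem IsHomogeneousPolynomial.isPolynomialMap {d : ℕ} {P : X → Y}
    (hP : IsHomogeneousPolynomial d P) : IsPolynomialMap P := by
  refine ⟨d, fun k => if k = d then P else 0, fun k => ?_, fun x => ?_⟩
  · by_cases h : k = d
    · subst h; simpa using hP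
    · simp only [h, if_false]
      exact ⟨0, fun x => by simp⟩
  · rw [Finset.sum_eq_single d] <;> simp +contextual

theorem isHomogeneousPolynomial_const (y : Y) :
    IsHomogeneousPolynomial 0 (fun _ : X => y) :=
  ⟨ContinuousMultilinearMap.constOfIsEmpty ℂ (fun _ : Fin 0 => X) y, fun x => by simp⟩

theorem isHomogeneousPolynomial_prod_smul {d : ℕ} (ψ : Fin d → StrongDual ℂ X) (y : Y) :
    IsHomogeneousPolynomial d (fun x => (∏ i, ψ i x) • y) :=
  ⟨((ContinuousMultilinearMap.mkPiAlgebra ℂ (Fin d) ℂ).compContinuousLinearMap ψ).smulRight y,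
    fun x => by simp⟩

end Polynomial

section NumericalRadius

variable {X : Type*} [NormedAddCommGroup X] [NormedSpace ℂ X]

theorem numericalRadius_nonneg (f : X → X) : 0 ≤ numericalRadius f :=
  Real.sSup_nonneg (by rintro _ ⟨x, φ, -, -, -, rfl⟩; exact norm_nonneg _)

theorem norm_apply_le_unitBallNorm [ProperSpace X] {f : X → X} (hf : Continuous f) {x : X}
    {φ : StrongDual ℂ X} (hx : ‖x‖ = 1) (hφ : ‖φ‖ = 1) : ‖φ (f x)‖ ≤ unitBallNorm f :=
  calc ‖φ (f x)‖ ≤ ‖φ‖ * ‖f x‖ := φ.le_opNorm _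
    _ = ‖f x‖ := by rw [hφ, one_mul]
    _ ≤ unitBallNorm f := norm_le_unitBallNorm hf hx.le

theorem numericalRadius_le_unitBallNorm [ProperSpace X] {f : X → X} (hf : Continuous f) :
    numericalRadius f ≤ unitBallNorm f := by
  refine Real.sSup_le ?_ (unitBallNorm_nonneg f)
  rintro _ ⟨x, φ, hx, hφ, -, rfl⟩
  exact norm_apply_le_unitBallNorm hf hx hφ

theorem norm_apply_le_numericalRadius [ProperSpace X] {f : X → X} (hf : Continuous f) {x : X}
    {φ : StrongDual ℂ X} (hx : ‖x‖ = 1) (hφ : ‖φ‖ = 1) (hφx : φ x = 1) :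
    ‖φ (f x)‖ ≤ numericalRadius f := by
  refine le_csSup ⟨unitBallNorm f, ?_⟩ ⟨x, φ, hx, hφ, hφx, rfl⟩
  rintro _ ⟨x, φ, hx, hφ, -, rfl⟩
  exact norm_apply_le_unitBallNorm hf hx hφ

theorem exists_norm_eq_numericalRadius [FiniteDimensional ℂ X] {f : X → X} (hf : Continuous f)
    (hpos : 0 < numericalRadius f) :
    ∃ (x : X) (φ : StrongDual ℂ X),
      ‖x‖ = 1 ∧ ‖φ‖ = 1 ∧ φ x = 1 ∧ ‖φ (f x)‖ = numericalRadius f := by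
  have : ProperSpace X := FiniteDimensional.proper ℂ X
  have : ProperSpace (StrongDual ℂ X) := FiniteDimensional.proper ℂ _
  have hK : IsCompact {p : X × StrongDual ℂ X | ‖p.1‖ = 1 ∧ ‖p.2‖ = 1 ∧ p.2 p.1 = 1} := by
    refine ((isCompact_closedBall (0 : X) 1).prod
      (isCompact_closedBall (0 : StrongDual ℂ X) 1)).of_isClosed_subset ?_ ?_
    · exact (isClosed_eq (by fun_prop) (by fun_prop)).inter
        ((isClosed_eq (by fun_prop) (by fun_prop)).inter
          (isClosed_eq (by fun_prop) (by fun_prop)))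
    · rintro ⟨x, φ⟩ ⟨hx, hφ, -⟩
      exact ⟨by simpa using hx.le, by simpa using hφ.le⟩
  have himg : {r : ℝ | ∃ (x : X) (φ : StrongDual ℂ X),
      ‖x‖ = 1 ∧ ‖φ‖ = 1 ∧ φ x = 1 ∧ r = ‖φ (f x)‖} =
      (fun p : X × StrongDual ℂ X => ‖p.2 (f p.1)‖) ''
        {p : X × StrongDual ℂ X | ‖p.1‖ = 1 ∧ ‖p.2‖ = 1 ∧ p.2 p.1 = 1} := by
    ext r
    constructor
    · rintro ⟨x, φ, h1, h2, h3, rfl⟩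
      exact ⟨(x, φ), ⟨h1, h2, h3⟩, rfl⟩
    · rintro ⟨⟨x, φ⟩, ⟨h1, h2, h3⟩, rfl⟩
      exact ⟨x, φ, h1, h2, h3, rfl⟩
  have hne : {r : ℝ | ∃ (x : X) (φ : StrongDual ℂ X),
      ‖x‖ = 1 ∧ ‖φ‖ = 1 ∧ φ x = 1 ∧ r = ‖φ (f x)‖}.Nonempty := by
    by_contra h
    rw [numericalRadius, Set.not_nonempty_iff_eq_empty.1 h, Real.sSup_empty] at hpos
    exact lt_irrefl _ hpos
  have hmem := (himg ▸ hK.image (by fun_prop) : IsCompact _).sSup_mem hne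
  obtain ⟨x, φ, h1, h2, h3, h4⟩ := hmem
  exact ⟨x, φ, h1, h2, h3, h4.symm⟩

/-- On an isometric copy of `ℓ_∞ⁿ` the numerical radius of a polynomial equals its norm:
by the maximum modulus principle in the `j`-th coordinate, the modulus of the `j`-th component
is as large at a point whose `j`-th coordinate is unimodular. -/
theorem numericalRadius_eq_unitBallNorm {n : ℕ} (hn : 1 ≤ n) (T : X ≃ₗᵢ[ℂ] (Fin n → ℂ))
    {P : X → X} (hP : Differentiable ℂ P) : numericalRadius P = unitBallNorm P := by
  have : FiniteDimensional ℂ X := T.symm.toLinearEquiv.finiteDimensional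
  have : ProperSpace X := FiniteDimensional.proper ℂ X
  have : Nonempty (Fin n) := ⟨⟨0, hn⟩⟩
  refine le_antisymm (numericalRadius_le_unitBallNorm hP.continuous) ?_
  obtain ⟨x, hx, hxP, -⟩ := exists_norm_eq_unitBallNorm hP.continuous
  obtain ⟨j, hj⟩ : ∃ j, ‖T (P x) j‖ = ‖P x‖ := by
    obtain ⟨j, -, hj⟩ := Finset.exists_mem_eq_sup Finset.univ Finset.univ_nonempty
      fun j => ‖T (P x) j‖₊
    exact ⟨j, by rw [← T.norm_map (P x), Pi.norm_def, hj, coe_nnnorm]⟩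
  have hupd : Differentiable ℂ fun s : ℂ => Function.update (T x) j s := fun s =>
    (hasDerivAt_update (T x) j s).differentiableAt
  have hF : Differentiable ℂ fun s : ℂ => T (P (T.symm (Function.update (T x) j s))) j :=
    (differentiable_pi.1 (T.toContinuousLinearEquiv.differentiable.comp
      (hP.comp (T.symm.toContinuousLinearEquiv.differentiable.comp hupd)))) j
  obtain ⟨s, hs, hmax⟩ := Complex.exists_mem_frontier_isMaxOn_norm
    (Metric.isBounded_ball (x := (0 : ℂ)) (r := 1)) ⟨0, by simp⟩ hF.diffContOnCl
  rw [frontier_ball _ one_ne_zero, mem_sphere_zero_iff_norm] at hs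
  have hxn : ∀ i, ‖T x i‖ ≤ 1 := fun i => (norm_le_pi_norm _ i).trans (by rwa [T.norm_map])
  have hlarge := hmax (a := T x j) (by
    rw [closure_ball _ one_ne_zero]; simpa using hxn j)
  simp only [Set.mem_ofPred_eq, Function.comp_apply, Function.update_eq_self,
    T.symm_apply_apply] at hlarge
  set z := T.symm (Function.update (T x) j s) with hz
  have hTz : T z j = s := by simp [hz]
  have hz1 : ‖z‖ = 1 := by
    rw [hz, T.symm.norm_map]
    apply le_antisymm
    · refine (pi_norm_le_iff_of_nonneg zero_le_one).2 fun i => ?_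
      by_cases h : i = j
      · subst h; simp [hs]
      · simpa [h] using hxn i
    · have := norm_le_pi_norm (Function.update (T x) j s) j
      simpa [hs] using this
  set φ : StrongDual ℂ X := (starRingEnd ℂ) s •
    (ContinuousLinearMap.proj j).comp (T.toContinuousLinearEquiv : X →L[ℂ] (Fin n → ℂ)) with hφ
  have hφa : ∀ w, φ w = (starRingEnd ℂ) s * T w j := fun w => rfl
  have hφz : φ z = 1 := by
    rw [hφa, hTz, mul_comm, Complex.mul_conj, Complex.normSq_eq_norm_sq, hs]; simp
  have hφ1 : ‖φ‖ = 1 := by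
    apply le_antisymm
    · refine φ.opNorm_le_bound zero_le_one fun w => ?_
      rw [hφa, norm_mul, RCLike.norm_conj, hs]
      gcongr
      exact (norm_le_pi_norm _ j).trans (T.norm_map w).le
    · have := φ.le_opNorm z
      rwa [hφz, hz1, norm_one, mul_one] at this
  calc unitBallNorm P = ‖T (P x) j‖ := by rw [hj, hxP]
    _ ≤ ‖T (P z) j‖ := hlarge
    _ = ‖φ (P z)‖ := by rw [hφa, norm_mul, RCLike.norm_conj, hs, one_mul]
    _ ≤ numericalRadius P := norm_apply_le_numericalRadius hP.continuous hz1 hφ1 hφz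

theorem analyticNumericalIndex_eq_one_of_isometry {n : ℕ} (hn : 1 ≤ n)
    (T : X ≃ₗᵢ[ℂ] (Fin n → ℂ)) : analyticNumericalIndex X = 1 := by
  have : FiniteDimensional ℂ X := T.symm.toLinearEquiv.finiteDimensional
  have : ProperSpace X := FiniteDimensional.proper ℂ X
  have : Nonempty (Fin n) := ⟨⟨0, hn⟩⟩
  have hset : {r : ℝ | ∃ P : X → X,
      IsPolynomialMap P ∧ unitBallNorm P = 1 ∧ r = numericalRadius P} = {1} := by
    refine Set.eq_singleton_iff_unique_mem.2 ⟨?_, ?_⟩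
    · have hpoly := (isHomogeneousPolynomial_const (X := X) (T.symm 1)).isPolynomialMap
      obtain ⟨x, -, hx, -⟩ := exists_norm_eq_unitBallNorm hpoly.differentiable.continuous
      have h1 : unitBallNorm (fun _ : X => T.symm 1) = 1 := by
        rw [← hx, T.symm.norm_map, norm_one]
      exact ⟨_, hpoly, h1, by
        rw [numericalRadius_eq_unitBallNorm hn T hpoly.differentiable, h1]⟩
    · rintro _ ⟨P, hP, h1, rfl⟩
      rw [numericalRadius_eq_unitBallNorm hn T hP.differentiable, h1]
  rw [analyticNumericalIndex, hset, csInf_singleton]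

end NumericalRadius

namespace IsAbsoluteNorm

variable {n : ℕ} {X : Type*} [NormedAddCommGroup X] [NormedSpace ℂ X]
  {e : Module.Basis (Fin n) ℂ X}

theorem norm_sum_congr (he : IsAbsoluteNorm e) {a b : Fin n → ℂ} (h : ∀ i, ‖a i‖ = ‖b i‖) :
    ‖∑ i, a i • e i‖ = ‖∑ i, b i • e i‖ := by
  rw [he.norm_sum_abs a, he.norm_sum_abs b]
  simp only [h]

theorem norm_coord_le (he : IsAbsoluteNorm e) (a : Fin n → ℂ) (j : Fin n) :
    ‖a j‖ ≤ ‖∑ i, a i • e i‖ := by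
  set b : Fin n → ℂ := fun i => if i = j then a i else -a i
  have hb : ‖∑ i, b i • e i‖ = ‖∑ i, a i • e i‖ :=
    he.norm_sum_congr fun i => by by_cases h : i = j <;> simp [b, h]
  have hsum : ∑ i, a i • e i + ∑ i, b i • e i = (2 * a j) • e j := by
    rw [← Finset.sum_add_distrib, Finset.sum_eq_single j]
    · simp [b, two_mul, add_smul]
    · intro i _ h; simp [b, h]
    · simp
  have := norm_add_le (∑ i, a i • e i) (∑ i, b i • e i)
  rw [hsum, hb, norm_smul, he.norm_basis, norm_mul] at this
  simp at this
  linarith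

/-- Every number of modulus at most `M` is, up to phase, the mean of two numbers of
modulus `M`. -/
theorem norm_sum_le_of_norm_coord_le (he : IsAbsoluteNorm e) {a : Fin n → ℂ} {M : ℝ}
    (h : ∀ i, ‖a i‖ ≤ M) : ‖∑ i, a i • e i‖ ≤ ‖∑ i, (M : ℂ) • e i‖ := by
  have key : ∀ ε : ℝ, ε ^ 2 = 1 →
      ‖∑ i, ((‖a i‖ : ℂ) + (ε * √(M ^ 2 - ‖a i‖ ^ 2) : ℝ) * Complex.I) • e i‖
        = ‖∑ i, (M : ℂ) • e i‖ := by
    intro ε hε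
    refine he.norm_sum_congr fun i => ?_
    have h0 := norm_nonneg (a i)
    have hM : 0 ≤ M := h0.trans (h i)
    rw [Complex.norm_add_mul_I, mul_pow, hε, one_mul, Real.sq_sqrt, Complex.norm_real,
      Real.norm_of_nonneg hM, add_sub_cancel, Real.sqrt_sq hM]
    nlinarith [h i]
  have hsum : ∑ i, ((‖a i‖ : ℂ) + ((1 : ℝ) * √(M ^ 2 - ‖a i‖ ^ 2) : ℝ) * Complex.I) • e i +
      ∑ i, ((‖a i‖ : ℂ) + ((-1 : ℝ) * √(M ^ 2 - ‖a i‖ ^ 2) : ℝ) * Complex.I) • e i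
        = (2 : ℂ) • ∑ i, (‖a i‖ : ℂ) • e i := by
    rw [← Finset.sum_add_distrib, Finset.smul_sum]
    refine Finset.sum_congr rfl fun i _ => ?_
    rw [← add_smul, smul_smul]
    congr 1
    push_cast
    ring
  have := norm_add_le
    (∑ i, ((‖a i‖ : ℂ) + ((1 : ℝ) * √(M ^ 2 - ‖a i‖ ^ 2) : ℝ) * Complex.I) • e i)
    (∑ i, ((‖a i‖ : ℂ) + ((-1 : ℝ) * √(M ^ 2 - ‖a i‖ ^ 2) : ℝ) * Complex.I) • e i)
  rw [key 1 (by norm_num), key (-1) (by norm_num), hsum, norm_smul, Complex.norm_ofNat] at this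
  rw [he.norm_sum_abs a]
  linarith

theorem sum_norm_mul_norm_le (he : IsAbsoluteNorm e) (φ : StrongDual ℂ X) (a : Fin n → ℂ) :
    ∑ i, ‖φ (e i)‖ * ‖a i‖ ≤ ‖φ‖ * ‖∑ i, a i • e i‖ := by
  have hphase : ∀ w : ℂ, ∃ u : ℂ, ‖u‖ = 1 ∧ u * w = ‖w‖ := fun w => by
    by_cases hw : w = 0
    · exact ⟨1, by simp, by simp [hw]⟩
    · have hn := (norm_pos_iff.2 hw).ne'
      have hn' : (‖w‖ : ℂ) ≠ 0 := by exact_mod_cast hn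
      refine ⟨‖w‖ / w, by simp [hn], by field_simp⟩
  choose u hu1 hu using fun i => hphase (φ (e i))
  have hnorm : ‖∑ i, (‖a i‖ * u i) • e i‖ = ‖∑ i, a i • e i‖ :=
    he.norm_sum_congr fun i => by simp [hu1]
  have happ : φ (∑ i, (‖a i‖ * u i) • e i) = ((∑ i, ‖φ (e i)‖ * ‖a i‖ : ℝ) : ℂ) := by
    rw [map_sum]
    push_cast
    refine Finset.sum_congr rfl fun i _ => ?_
    rw [map_smul, smul_eq_mul, mul_assoc, hu, mul_comm]
  have := φ.le_opNorm (∑ i, (‖a i‖ * u i) • e i)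
  rw [hnorm, happ, Complex.norm_real] at this
  exact (le_abs_self _).trans this

theorem nonempty_isometry (hn : 1 ≤ n) (he : IsAbsoluteNorm e) (h : ‖∑ i, e i‖ ≤ 1) :
    Nonempty (X ≃ₗᵢ[ℂ] (Fin n → ℂ)) := by
  have : Nonempty (Fin n) := ⟨⟨0, hn⟩⟩
  refine ⟨⟨e.equivFun, fun x => ?_⟩⟩
  have hx : ∑ i, e.equivFun x i • e i = x := e.sum_equivFun x
  apply le_antisymm
  · refine (pi_norm_le_iff_of_nonneg (norm_nonneg _)).2 fun i => ?_
    have := he.norm_coord_le (e.equivFun x) i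
    rwa [hx] at this
  · have h1 := he.norm_sum_le_of_norm_coord_le (a := e.equivFun x) (M := ‖e.equivFun x‖)
      fun i => norm_le_pi_norm _ i
    rw [hx, ← Finset.smul_sum, norm_smul, Complex.norm_real, norm_norm] at h1
    exact h1.trans (mul_le_of_le_one_right (norm_nonneg _) h)

end IsAbsoluteNorm

section SumMulProd

variable {n : ℕ} {X : Type*} [NormedAddCommGroup X] [NormedSpace ℂ X]

/-- The scalar polynomial `(∑ xᵢ) ∏ xᵢ`. A point of the unit ball where its modulus is maximal
has nonzero coordinates with a common phase. -/
noncomputable def sumMulProd (e : Module.Basis (Fin n) ℂ X) (x : X) : ℂ :=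
  (∑ i, e.repr x i) * ∏ i, e.repr x i

theorem isHomogeneousPolynomial_sumMulProd_smul (e : Module.Basis (Fin n) ℂ X) (y : X) :
    IsHomogeneousPolynomial (n + 1) (fun x => sumMulProd e x • y) := by
  have : FiniteDimensional ℂ X := e.finiteDimensional_of_finite
  have h := isHomogeneousPolynomial_prod_smul
    (Fin.cons (∑ i, LinearMap.toContinuousLinearMap (e.coord i))
      (fun i => LinearMap.toContinuousLinearMap (e.coord i)) : Fin (n + 1) → StrongDual ℂ X) y
  convert h using 3 with x
  simp [sumMulProd, Fin.prod_univ_succ]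

theorem continuous_sumMulProd (e : Module.Basis (Fin n) ℂ X) : Continuous (sumMulProd e) := by
  have : FiniteDimensional ℂ X := e.finiteDimensional_of_finite
  have h : ∀ i, Continuous fun x => e.repr x i := fun i =>
    (LinearMap.toContinuousLinearMap (e.coord i)).continuous
  exact (continuous_finsetSum _ fun i _ => h i).mul (continuous_finsetProd _ fun i _ => h i)

theorem unitBallNorm_sumMulProd_pos (hn : 1 ≤ n) (e : Module.Basis (Fin n) ℂ X) :
    0 < unitBallNorm (sumMulProd e) := by
  have : FiniteDimensional ℂ X := e.finiteDimensional_of_finite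
  have : ProperSpace X := FiniteDimensional.proper ℂ X
  set c : ℂ := ((1 + ‖∑ i, e i‖ : ℝ) : ℂ)⁻¹
  have hpos : 0 < 1 + ‖∑ i, e i‖ := by positivity
  have hc : c ≠ 0 := inv_ne_zero (by exact_mod_cast hpos.ne')
  have hx : ‖c • ∑ i, e i‖ ≤ 1 := by
    rw [norm_smul, norm_inv, Complex.norm_real, Real.norm_of_nonneg hpos.le,
      inv_mul_le_iff₀ hpos]
    linarith
  refine lt_of_lt_of_le (norm_pos_iff.2 ?_) (norm_le_unitBallNorm (continuous_sumMulProd e) hx)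
  have hr : ∀ i, e.repr (c • ∑ i, e i) i = c := fun i => by
    simp [Finsupp.single_apply]
  simp only [sumMulProd, hr, Finset.sum_const, Finset.prod_const, Finset.card_univ,
    Fintype.card_fin, nsmul_eq_mul]
  have : (n : ℂ) ≠ 0 := by exact_mod_cast (by omega : n ≠ 0)
  exact mul_ne_zero (mul_ne_zero this hc) (pow_ne_zero _ hc)

theorem IsAbsoluteNorm.exists_phase_of_norm_sumMulProd_eq (hn : 1 ≤ n)
    {e : Module.Basis (Fin n) ℂ X} (he : IsAbsoluteNorm e) {x : X} (hx : ‖x‖ ≤ 1)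
    (hmax : ‖sumMulProd e x‖ = unitBallNorm (sumMulProd e)) :
    (∀ i, e.repr x i ≠ 0) ∧ ∃ u : ℂ, ‖u‖ = 1 ∧ ∀ i, e.repr x i = ‖e.repr x i‖ * u := by
  have : FiniteDimensional ℂ X := e.finiteDimensional_of_finite
  have : ProperSpace X := FiniteDimensional.proper ℂ X
  have hne : sumMulProd e x ≠ 0 :=
    norm_pos_iff.1 (hmax ▸ unitBallNorm_sumMulProd_pos hn e)
  have hprod : ∏ i, e.repr x i ≠ 0 := right_ne_zero_of_mul hne
  refine ⟨fun i => Finset.prod_ne_zero_iff.1 hprod i (Finset.mem_univ i),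
    exists_phase_of_norm_sum_eq _ (le_antisymm (norm_sum_le _ _) ?_)⟩
  have hx' : ‖∑ i, (‖e.repr x i‖ : ℂ) • e i‖ ≤ 1 := by
    rw [← he.norm_sum_abs, e.sum_repr]
    exact hx
  have hr : ∀ j, e.repr (∑ i, (‖e.repr x i‖ : ℂ) • e i) j = ‖e.repr x j‖ := fun j => by
    rw [e.repr_sum_self]
  have hle := norm_le_unitBallNorm (continuous_sumMulProd e) hx'
  rw [← hmax, sumMulProd, sumMulProd, norm_mul, norm_mul] at hle
  simp only [hr] at hle
  rw [← Complex.ofReal_sum, ← Complex.ofReal_prod, Complex.norm_real, Complex.norm_real,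
    Real.norm_of_nonneg (by positivity), Real.norm_of_nonneg (by positivity), norm_prod] at hle
  refine le_of_mul_le_mul_right hle ?_
  rw [← norm_prod]
  exact norm_pos_iff.2 hprod

theorem IsAbsoluteNorm.exists_phase_of_apply_eq_one {e : Module.Basis (Fin n) ℂ X}
    (he : IsAbsoluteNorm e) {x : X} {φ : StrongDual ℂ X} (hx : ‖x‖ = 1) (hφ : ‖φ‖ = 1)
    (hφx : φ x = 1) (hx0 : ∀ i, e.repr x i ≠ 0) {u : ℂ} (hu1 : ‖u‖ = 1)
    (hu : ∀ i, e.repr x i = ‖e.repr x i‖ * u) :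
    ∃ w : ℂ, ‖w‖ = 1 ∧ ∀ i, φ (e i) = ‖φ (e i)‖ * w := by
  have hu0 : u ≠ 0 := norm_pos_iff.1 (by rw [hu1]; exact one_pos)
  have hsum : φ x = ∑ i, e.repr x i * φ (e i) := by
    conv_lhs => rw [← e.sum_repr x, map_sum]
    simp only [map_smul, smul_eq_mul]
  have hle := he.sum_norm_mul_norm_le φ (e.repr x)
  rw [e.sum_repr, hφ, hx, one_mul] at hle
  obtain ⟨w, hw1, hw⟩ := exists_phase_of_norm_sum_eq (fun i => e.repr x i * φ (e i)) (by
    refine le_antisymm (norm_sum_le _ _) ?_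
    rw [← hsum, hφx, norm_one]
    simpa only [norm_mul, mul_comm] using hle)
  refine ⟨w / u, by rw [norm_div, hw1, hu1, div_one], fun i => ?_⟩
  have hi := hw i
  have hn0 : (‖e.repr x i‖ : ℂ) ≠ 0 := by exact_mod_cast (norm_pos_iff.2 (hx0 i)).ne'
  simp only [norm_mul, Complex.ofReal_mul] at hi
  have hi' : (‖e.repr x i‖ : ℂ) * (u * φ (e i)) = ‖e.repr x i‖ * (‖φ (e i)‖ * w) := by
    rw [← mul_assoc, ← hu i, hi]; ring
  rw [mul_div_assoc', eq_div_iff hu0, mul_comm]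
  exact mul_left_cancel₀ hn0 hi'

theorem IsAbsoluteNorm.norm_sum_basis_le_one_of_phase {e : Module.Basis (Fin n) ℂ X}
    (he : IsAbsoluteNorm e) {φ : StrongDual ℂ X} (hφ : ‖φ‖ = 1) {ζ : Fin n → ℂ}
    (hζ1 : ∀ i, ‖ζ i‖ = 1) (hζ : Function.Injective ζ) {w : ℂ} (hw1 : ‖w‖ = 1)
    (hw : ∀ i, φ (e i) = ‖φ (e i)‖ * w) (hφζ : ‖∑ i, ζ i * φ (e i)‖ = ‖∑ i, e i‖) :
    ‖∑ i, e i‖ ≤ 1 := by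
  by_cases hall : ∀ j, φ (e j) = 0
  · rw [← hφζ]
    simp [hall]
  obtain ⟨j, hj⟩ := not_forall.1 hall
  have hNζ : ‖∑ i, ζ i • e i‖ = ‖∑ i, e i‖ := by
    rw [he.norm_sum_congr (b := 1) fun i => by simp [hζ1]]
    simp
  have hleN : ∑ i, ‖φ (e i)‖ ≤ ‖∑ i, e i‖ := by
    have := he.sum_norm_mul_norm_le φ ζ
    simpa [hζ1, hφ, hNζ] using this
  obtain ⟨v, hv1, hvζ⟩ := exists_phase_of_norm_sum_eq (fun i => ζ i * φ (e i)) (by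
    refine le_antisymm (norm_sum_le _ _) ?_
    rw [hφζ]
    simpa [hζ1] using hleN)
  have hw0 : w ≠ 0 := norm_pos_iff.1 (by rw [hw1]; exact one_pos)
  have hphase : ∀ i, φ (e i) ≠ 0 → ζ i = v / w := fun i hi => by
    have hn0 : (‖φ (e i)‖ : ℂ) ≠ 0 := by exact_mod_cast (norm_pos_iff.2 hi).ne'
    have h2 := hvζ i
    simp only [norm_mul, hζ1, one_mul] at h2
    rw [eq_div_iff hw0]
    refine mul_left_cancel₀ hn0 ?_
    rw [← h2, mul_left_comm, ← hw i]
  rw [Finset.sum_eq_single j (fun i _ hij => by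
      by_contra hne
      exact hij (hζ ((hphase i (right_ne_zero_of_mul hne)).trans (hphase j hj).symm)))
    (by simp), norm_mul, hζ1, one_mul] at hφζ
  have := φ.le_opNorm (e j)
  rwa [hφζ, hφ, he.norm_basis, one_mul] at this

theorem IsAbsoluteNorm.norm_sum_basis_le_one (hn : 1 ≤ n)
    {e : Module.Basis (Fin n) ℂ X} (he : IsAbsoluteNorm e)
    (h1 : analyticNumericalIndex X = 1) : ‖∑ i, e i‖ ≤ 1 := by
  have : FiniteDimensional ℂ X := e.finiteDimensional_of_finite
  have : ProperSpace X := FiniteDimensional.proper ℂ X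
  obtain ⟨ζ, hζ1, hζ⟩ : ∃ ζ : Fin n → ℂ, (∀ i, ‖ζ i‖ = 1) ∧ Function.Injective ζ := by
    have hprim := Complex.isPrimitiveRoot_exp n (by omega)
    refine ⟨fun i => Complex.exp (2 * Real.pi * Complex.I / n) ^ (i : ℕ), fun i => ?_,
      fun i j hij => Fin.ext (hprim.pow_inj i.2 j.2 hij)⟩
    rw [norm_pow, hprim.norm'_eq_one (by omega), one_pow]
  set N := ‖∑ i, e i‖ with hN
  set M := unitBallNorm (sumMulProd e) with hM
  have hMpos : 0 < M := unitBallNorm_sumMulProd_pos hn e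
  have hNζ : ‖∑ i, ζ i • e i‖ = N := by
    rw [hN, he.norm_sum_congr (b := 1) fun i => by simp [hζ1]]
    simp
  have hNpos : 0 < N := by
    have := he.norm_coord_le ζ ⟨0, hn⟩
    rw [hζ1, hNζ] at this
    linarith
  set y : X := ((M * N : ℝ) : ℂ)⁻¹ • ∑ i, ζ i • e i with hy
  have hynorm : ‖y‖ = M⁻¹ := by
    rw [hy, norm_smul, norm_inv, Complex.norm_real, Real.norm_of_nonneg (by positivity), hNζ]
    field_simp
  have hpoly := (isHomogeneousPolynomial_sumMulProd_smul e y).isPolynomialMap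
  have hcont := hpoly.differentiable.continuous
  have hP1 : unitBallNorm (fun x => sumMulProd e x • y) = 1 := by
    rw [unitBallNorm_smul_const (continuous_sumMulProd e), hynorm, ← hM,
      mul_inv_cancel₀ hMpos.ne']
  have hv : numericalRadius (fun x => sumMulProd e x • y) = 1 := by
    refine le_antisymm (hP1 ▸ numericalRadius_le_unitBallNorm hcont) (h1 ▸ ?_)
    refine csInf_le ⟨0, ?_⟩ ⟨_, hpoly, hP1, rfl⟩
    rintro _ ⟨P, -, -, rfl⟩
    exact numericalRadius_nonneg P
  obtain ⟨x, φ, hx, hφ, hφx, hφP⟩ :=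
    exists_norm_eq_numericalRadius hcont (by rw [hv]; exact one_pos)
  rw [hv, map_smul, smul_eq_mul, norm_mul] at hφP
  have hgx : ‖sumMulProd e x‖ ≤ M := norm_le_unitBallNorm (continuous_sumMulProd e) hx.le
  have hφy : ‖φ y‖ ≤ M⁻¹ := by
    have := φ.le_opNorm y
    rwa [hφ, one_mul, hynorm] at this
  have hMM : M * M⁻¹ = 1 := mul_inv_cancel₀ hMpos.ne'
  have hgx' : ‖sumMulProd e x‖ = M := by
    refine le_antisymm hgx ?_
    have h2 : ‖sumMulProd e x‖ * ‖φ y‖ ≤ ‖sumMulProd e x‖ * M⁻¹ :=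
      mul_le_mul_of_nonneg_left hφy (norm_nonneg _)
    rw [hφP, ← hMM] at h2
    exact le_of_mul_le_mul_right h2 (inv_pos.2 hMpos)
  have hφy' : ‖φ y‖ = M⁻¹ := by
    rw [hgx'] at hφP
    exact eq_inv_of_mul_eq_one_right hφP
  obtain ⟨hx0, u, hu1, hu⟩ := he.exists_phase_of_norm_sumMulProd_eq hn hx.le hgx'
  obtain ⟨w, hw1, hw⟩ := he.exists_phase_of_apply_eq_one hx hφ hφx hx0 hu1 hu
  have hφζ : ‖∑ i, ζ i * φ (e i)‖ = N := by
    have hφy2 : φ y = ((M * N : ℝ) : ℂ)⁻¹ * ∑ i, ζ i * φ (e i) := by simp [hy]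
    rw [hφy2, norm_mul, norm_inv, Complex.norm_real, Real.norm_of_nonneg (by positivity)] at hφy'
    field_simp at hφy'
    exact hφy'
  exact he.norm_sum_basis_le_one_of_phase hφ hζ1 hζ hw1 hw hφζ

end SumMulProd

theorem mainTheorem6 {n : ℕ} (hn : 1 ≤ n) {X : Type*} [NormedAddCommGroup X] [NormedSpace ℂ X]
    (e : Module.Basis (Fin n) ℂ X) (he : IsAbsoluteNorm e) :
    analyticNumericalIndex X = 1 ↔ Nonempty (X ≃ₗᵢ[ℂ] (Fin n → ℂ)) :=
  ⟨fun h => he.nonempty_isometry hn (he.norm_sum_basis_le_one hn h),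
    fun ⟨T⟩ => analyticNumericalIndex_eq_one_of_isometry hn T⟩
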